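/- Let $G_{n,p}$ be the random graph on the vertex set $\{1,\dots,n\}$ in which each pair of distinct vertices is joined by an edge independently with probability $p=p(n)\in[0,1]$, and let $\mathcal A(0)$ be a random set of vertices, independent of the graph, that contains each vertex independently with a fixed probability $q\in(0,1)$. In majority bootstrap percolation the vertices of $\mathcal A(0)$ are initially active; active vertices stay active forever, and in each round every inactive vertex that has a majority of active neighbours becomes active, until no more vertices become active. Here a majority may be read, throughout the process, in either of two ways: (a) strictly more active than inactive neighbours; or (b) at least as many active as inactive neighbours, and at least one active neighbour. Let $A(0)=|\mathcal A(0)|$, and let $A^*$ be the number of vertices that are active at the end. For random variables $X_n$ and numbers $a_n\ge 0$, write $X_n=o_p(a_n)$ if $\lim_{n\to\infty}\mathbb P(|X_n|>\varepsilon a_n)=0$ for every $\varepsilon>0$. Suppose that $1/n\ll p\le 1$, that is, $1/n=o(p(n))$, or equivalently $np(n)\to\infty$, as $n\to\infty$. Then, for each of the two rules (a) and (b): (i) if $q<1/2$, then $A^*=A(0)\,(1+o_p(1))$; (ii) if $q>1/2$, then $A^*=n-o_p(n)$. -/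

import Mathlib

open Filter Asymptotics MeasureTheory ProbabilityTheory
open scoped Topology unitInterval

namespace MajorityBootstrap

/-- The convention for vertices that have as many active as inactive neighbours. -/
inductive TieRule where
  /-- A vertex needs strictly more active than inactive neighbours. -/
  | strict
  /-- A vertex needs at least one active neighbour and at least as many active as inactive ones. -/
  | weak

variable {V : Type*}

/-- `v` meets the majority condition in `G` when the set of active vertices is `A`. -/
def Activates (rule : TieRule) (G : SimpleGraph V) (A : Set V) (v : V) : Prop :=
  match rule with
  | .strict => (G.neighborSet v \ A).ncard < (G.neighborSet v ∩ A).ncard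
  | .weak => max (G.neighborSet v \ A).ncard 1 ≤ (G.neighborSet v ∩ A).ncard

/-- One round: active vertices stay active, and every vertex that meets the majority condition
becomes active. -/
def step (rule : TieRule) (G : SimpleGraph V) (A : Set V) : Set V :=
  A ∪ {v | Activates rule G A v}

/-- The final active set: everything that is active after some number of rounds. -/
def finalSet (rule : TieRule) (G : SimpleGraph V) (A : Set V) : Set V :=
  ⋃ k : ℕ, (step rule G)^[k] A

/-- The pair (random graph `G(n, p)`, initial set `𝒜(0)`): the graph and the set are independent,
and the set contains each vertex independently with probability `q`. -/
noncomputable def law (n : ℕ) (p q : I) : Measure (SimpleGraph (Fin n) × Set (Fin n)) :=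
  (SimpleGraph.binomialRandom (Fin n) p).prod (setBernoulli Set.univ q)

/-- The initial number `A(0)` of active vertices. -/
noncomputable def initialSize {n : ℕ} (ω : SimpleGraph (Fin n) × Set (Fin n)) : ℕ :=
  ω.2.ncard

/-- The final number `A*` of active vertices. -/
noncomputable def finalSize (rule : TieRule) {n : ℕ} (ω : SimpleGraph (Fin n) × Set (Fin n)) : ℕ :=
  (finalSet rule ω.1 ω.2).ncard

/-- `X n = o_p(a n)` as `n → ∞`, where `X n` lives on the probability space `(Ω n, μ n)`. -/
def IsLittleOInProb {Ω : ℕ → Type*} [∀ n, MeasurableSpace (Ω n)] (μ : ∀ n, Measure (Ω n))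
    (X : ∀ n, Ω n → ℝ) (a : ℕ → ℝ) : Prop :=
  ∀ ε : ℝ, 0 < ε → Tendsto (fun n => μ n {ω | ε * a n < |X n ω|}) atTop (𝓝 0)

end MajorityBootstrap

namespace MajorityBootstrap

/-! The excess of `v`, inactive minus active neighbours at time zero, has mean `(n-1)p(1-2q)` and
variance at most `(n-1)p`. As `np → ∞`, Chebyshev and Markov leave only `o(n)` atypical vertices in
probability (`measureReal_ncard_atypical_ge`); every other excess is within half the absolute mean,
hence has its sign.

If `q > 1/2`, every typical vertex activates in the first round.

If `q < 1/2`, suppose that more than `s ≈ dn` vertices are activated later, and let `S` be the first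
`s` of them. When `v ∈ S` activates, all active vertices lie in `A ∪ S`, so its excess is at most
twice its degree into `S` (`exists_finset_excess_le`). Most of `S` being typical, the degrees inside
`S` then sum to at least `2s²p` for small `d`, about twice the expectation. Chernoff and a union
bound over at most `2^n` sets exclude this, because `s²p` is much larger than `n`. -/

instance discreteMeasurableSpace_simpleGraph {V : Type*} [Finite V] :
    DiscreteMeasurableSpace (SimpleGraph V) where
  forall_measurableSet _ :=
    SimpleGraph.measurableEmbedding_edgeSet.measurableSet_image.1 (.of_discrete)

/-! ### Product formulas for Bernoulli random sets and binomial random graphs -/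

open Classical in
/-- The integral of a product of functions of the separate coordinates of a Bernoulli random set
is the product of the integrals. -/
lemma integral_setBernoulli_prod {ι : Type*} [Fintype ι] (u : Set ι) (p : I)
    (f : ι → Prop → ℝ) :
    ∫ s, ∏ i, f i (i ∈ s) ∂(setBernoulli u p)
      = ∏ i, ((p : ℝ) * f i (i ∈ u) + (1 - (p : ℝ)) * f i False) := by
  rw [setBernoulli_eq_map, integral_map (Measurable.of_discrete).aemeasurable
    (Measurable.of_discrete).aestronglyMeasurable, Measure.infinitePi_eq_pi]
  simp only [Set.mem_ofPred_eq]
  rw [integral_fintype_prod_eq_prod (μ := fun i : ι ↦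
    unitInterval.toNNReal p • Measure.dirac (i ∈ u) +
      unitInterval.toNNReal (unitInterval.symm p) • Measure.dirac False)]
  refine Finset.prod_congr rfl fun i _ ↦ ?_
  rw [integral_add_measure (.of_finite) (.of_finite), integral_smul_nnreal_measure,
    integral_smul_nnreal_measure, integral_dirac, integral_dirac]
  simp [NNReal.smul_def]

/-- The product formula for a subfamily of coordinates. -/
lemma integral_setBernoulli_prod_finset {ι : Type*} [Fintype ι] (u : Set ι) (p : I)
    (T : Finset ι) (hT : ∀ i ∈ T, i ∈ u) (f : ι → Prop → ℝ) :
    ∫ s, ∏ i ∈ T, f i (i ∈ s) ∂(setBernoulli u p)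
      = ∏ i ∈ T, ((p : ℝ) * f i True + (1 - (p : ℝ)) * f i False) := by
  classical
  have h := integral_setBernoulli_prod u p (fun i P ↦ if i ∈ T then f i P else 1)
  simp only [Finset.prod_ite_mem, Finset.univ_inter] at h
  rw [h, ← Finset.prod_subset (Finset.subset_univ T)]
  · refine Finset.prod_congr rfl fun i hi ↦ ?_
    simp [hi, hT i hi]
  · intro i _ hi
    simp [hi]

/-- Almost every sampled set avoids the diagonal, so it is recovered as the edge set of its graph.
-/
lemma integral_binomialRandom {V : Type*} [Fintype V] (p : I) (F : Set (Sym2 V) → ℝ) :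
    ∫ G : SimpleGraph V, F G.edgeSet ∂(SimpleGraph.binomialRandom V p)
      = ∫ s, F s ∂(setBernoulli (Sym2.diagSetᶜ : Set (Sym2 V)) p) := by
  rw [SimpleGraph.binomialRandom_eq_map, integral_map (Measurable.of_discrete).aemeasurable
    (Measurable.of_discrete).aestronglyMeasurable]
  refine integral_congr_ae ?_
  filter_upwards [setBernoulli_ae_subset] with s hs
  congr 1
  rw [SimpleGraph.edgeSet_fromEdgeSet, sdiff_eq_left, ← Set.subset_compl_iff_disjoint_right]
  exact hs

lemma integral_binomialRandom_prod_finset {V : Type*} [Fintype V] (p : I)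
    (T : Finset (Sym2 V)) (hT : ∀ e ∈ T, ¬ e.IsDiag) (f : Sym2 V → Prop → ℝ) :
    ∫ G : SimpleGraph V, ∏ e ∈ T, f e (e ∈ G.edgeSet) ∂(SimpleGraph.binomialRandom V p)
      = ∏ e ∈ T, ((p : ℝ) * f e True + (1 - (p : ℝ)) * f e False) := by
  rw [integral_binomialRandom p (fun s ↦ ∏ e ∈ T, f e (e ∈ s))]
  exact integral_setBernoulli_prod_finset _ p T (by simpa using hT) f

/-! ### Chebyshev's inequality for sums of pairwise uncorrelated variables -/

lemma measureReal_abs_sum_sub_ge {Ω ι : Type*} [MeasurableSpace Ω] [Finite Ω]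
    [DiscreteMeasurableSpace Ω] (μ : Measure Ω) [IsProbabilityMeasure μ] (W : Finset ι)
    (X : ι → Ω → ℝ) (a b : ℝ) (h1 : ∀ i ∈ W, ∫ ω, X i ω ∂μ = a)
    (h2 : ∀ i ∈ W, ∫ ω, X i ω * X i ω ∂μ ≤ b)
    (h3 : ∀ i ∈ W, ∀ j ∈ W, i ≠ j → ∫ ω, X i ω * X j ω ∂μ = a * a) {t : ℝ} (ht : 0 < t) :
    μ.real {ω | t ≤ |∑ i ∈ W, X i ω - W.card * a|} ≤ W.card * b / t ^ 2 := by
  classical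
  have hL (Y : Ω → ℝ) : MemLp Y 2 μ := by
    obtain ⟨C, hC⟩ := Set.finite_range (fun ω ↦ ‖Y ω‖) |>.bddAbove
    exact MemLp.of_bound (Measurable.of_discrete).aestronglyMeasurable C
      (.of_forall fun ω ↦ hC ⟨ω, rfl⟩)
  have hmean : ∫ ω, (∑ i ∈ W, X i) ω ∂μ = W.card * a := by
    simp only [Finset.sum_apply]
    rw [integral_finsetSum _ (fun _ _ ↦ .of_finite), Finset.sum_congr rfl h1]
    simp
  have hvar : Var[∑ i ∈ W, X i; μ] ≤ W.card * b := by
    rw [variance_sum' (fun i _ ↦ hL _)]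
    calc ∑ i ∈ W, ∑ j ∈ W, cov[X i, X j; μ]
        ≤ ∑ i ∈ W, ∑ j ∈ W, (if i = j then b else 0) := by
          refine Finset.sum_le_sum fun i hi ↦ Finset.sum_le_sum fun j hj ↦ ?_
          rw [covariance_eq_sub (hL _) (hL _), h1 i hi, h1 j hj]
          simp only [Pi.mul_apply]
          split_ifs with hij
          · subst hij
            nlinarith [h2 i hi, mul_self_nonneg a]
          · rw [h3 i hi j hj hij]
            simp
      _ = W.card * b := by simp
  have h := meas_ge_le_variance_div_sq (μ := μ) (hL (∑ i ∈ W, X i)) ht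
  rw [hmean] at h
  simp only [Finset.sum_apply] at h
  have h' := ENNReal.toReal_mono ENNReal.ofReal_ne_top h
  rw [ENNReal.toReal_ofReal (div_nonneg (variance_nonneg _ _) (sq_nonneg _))] at h'
  refine h'.trans ?_
  gcongr

instance isProbabilityMeasure_law (n : ℕ) (p q : I) : IsProbabilityMeasure (law n p q) := by
  unfold law; infer_instance

/-! ### The excess of inactive over active neighbours -/

/-- The number of neighbours of `v` outside `A` minus the number of neighbours in `A`. -/
noncomputable def excess {V : Type*} (G : SimpleGraph V) (A : Set V) (v : V) : ℝ :=
  ((G.neighborSet v \ A).ncard : ℝ) - ((G.neighborSet v ∩ A).ncard : ℝ)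

open Classical in
lemma ncard_eq_sum_indicator {V : Type*} [Fintype V] (s : Set V) :
    (s.ncard : ℝ) = ∑ w, if w ∈ s then (1 : ℝ) else 0 := by
  rw [Finset.sum_boole, Set.ncard_eq_toFinset_card', ← Set.filter_mem_univ_eq_toFinset]

open Classical in
lemma excess_eq_sum {V : Type*} [Fintype V] [DecidableEq V] (G : SimpleGraph V) (A : Set V) (v : V) :
    excess G A v = ∑ w ∈ Finset.univ.erase v,
      (if s(v, w) ∈ G.edgeSet then (1 : ℝ) else 0) * (if w ∈ A then (-1 : ℝ) else 1) := by
  rw [excess, ncard_eq_sum_indicator, ncard_eq_sum_indicator, ← Finset.sum_sub_distrib,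
    Finset.sum_erase _ (by simp)]
  refine Finset.sum_congr rfl fun w _ ↦ ?_
  by_cases h1 : G.Adj v w <;> by_cases h2 : w ∈ A <;> simp [h1, h2]

lemma integral_law_mul {n : ℕ} (p q : I) (f : SimpleGraph (Fin n) → ℝ) (g : Set (Fin n) → ℝ) :
    ∫ ω, f ω.1 * g ω.2 ∂(law n p q)
      = (∫ G, f G ∂(SimpleGraph.binomialRandom (Fin n) p)) *
        ∫ A, g A ∂(setBernoulli Set.univ q) :=
  integral_prod_mul f g

/-- Each summand is an edge indicator times a sign. Different `w` involve different edges and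
different vertices, so the summands are uncorrelated; the sign squares to 1, so the second moment is
`p`. -/
lemma measureReal_excess_deviation (n : ℕ) (p q : I) (v : Fin n) {t : ℝ} (ht : 0 < t) :
    (law n p q).real {ω | t ≤ |excess ω.1 ω.2 v - ((n : ℝ) - 1) * (p * (1 - 2 * q))|}
      ≤ ((n : ℝ) - 1) * p / t ^ 2 := by
  classical
  have hcard : (((Finset.univ : Finset (Fin n)).erase v).card : ℝ) = (n : ℝ) - 1 := by
    rw [Finset.card_erase_of_mem (Finset.mem_univ v), Finset.card_univ, Fintype.card_fin,
      Nat.cast_sub (by have := v.2; omega)]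
    simp
  have hG1 (w : Fin n) (hw : w ≠ v) :
      ∫ G : SimpleGraph (Fin n), (if s(v, w) ∈ G.edgeSet then (1 : ℝ) else 0)
        ∂(SimpleGraph.binomialRandom (Fin n) p) = p := by
    have := integral_binomialRandom_prod_finset p {s(v, w)} (by simpa using hw.symm)
      (fun _ P ↦ if P then (1 : ℝ) else 0)
    simpa using this
  have hA1 (w : Fin n) :
      ∫ A : Set (Fin n), (if w ∈ A then (-1 : ℝ) else 1) ∂(setBernoulli Set.univ q)
        = 1 - 2 * q := by
    have := integral_setBernoulli_prod_finset Set.univ q {w} (by simp)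
      (fun _ P ↦ if P then (-1 : ℝ) else 1)
    simp only [Finset.prod_singleton, if_true, if_false] at this
    rw [this]; ring
  have key := measureReal_abs_sum_sub_ge (law n p q) (Finset.univ.erase v)
    (fun w ω ↦ (if s(v, w) ∈ ω.1.edgeSet then (1 : ℝ) else 0) *
      (if w ∈ ω.2 then (-1 : ℝ) else 1)) (p * (1 - 2 * q)) p ?_ ?_ ?_ ht
  · simp only [hcard] at key
    simpa only [excess_eq_sum] using key
  · intro w hw
    rw [integral_law_mul p q (fun G ↦ if s(v, w) ∈ G.edgeSet then (1 : ℝ) else 0)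
      (fun A ↦ if w ∈ A then (-1 : ℝ) else 1), hG1 w (Finset.ne_of_mem_erase hw), hA1]
  · intro w hw
    rw [← hG1 w (Finset.ne_of_mem_erase hw)]
    have := integral_law_mul p q (fun G ↦ if s(v, w) ∈ G.edgeSet then (1 : ℝ) else 0)
      (fun _ ↦ 1)
    simp only [mul_one, integral_const, probReal_univ, smul_eq_mul] at this
    rw [← this]
    refine le_of_eq (integral_congr_ae (.of_forall fun ω ↦ ?_))
    dsimp only
    split_ifs <;> norm_num
  · intro w hw w' hw' hne
    have hwv := Finset.ne_of_mem_erase hw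
    have hwv' := Finset.ne_of_mem_erase hw'
    have hne' : s(v, w) ≠ s(v, w') := by
      simpa [Sym2.eq_iff, hwv.symm, hwv'.symm] using fun h : w = w' ↦ hne h
    have hG2 := integral_binomialRandom_prod_finset p {s(v, w), s(v, w')}
      (by simp [hwv.symm, hwv'.symm])
      (fun _ P ↦ if P then (1 : ℝ) else 0)
    have hA2 := integral_setBernoulli_prod_finset Set.univ q {w, w'} (by simp)
      (fun _ P ↦ if P then (-1 : ℝ) else 1)
    simp only [Finset.prod_pair hne', Finset.prod_pair hne, if_true, if_false] at hG2 hA2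
    have hG3 : ∫ G : SimpleGraph (Fin n), (if s(v, w) ∈ G.edgeSet then (1 : ℝ) else 0) *
        (if s(v, w') ∈ G.edgeSet then (1 : ℝ) else 0)
          ∂(SimpleGraph.binomialRandom (Fin n) p) = p * p := by
      refine Eq.trans ?_ (hG2.trans (by ring))
      congr!
    have := integral_law_mul p q
      (fun G ↦ (if s(v, w) ∈ G.edgeSet then (1 : ℝ) else 0) *
        (if s(v, w') ∈ G.edgeSet then (1 : ℝ) else 0))
      (fun A ↦ (if w ∈ A then (-1 : ℝ) else 1) * (if w' ∈ A then (-1 : ℝ) else 1))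
    rw [hG3, hA2] at this
    calc _ = _ := integral_congr_ae (.of_forall fun ω ↦ by ring)
      _ = _ := this
      _ = _ := by ring

/-- The vertices whose excess in the initial configuration is far from its expectation. -/
def atypical {n : ℕ} (p q : I) (ω : SimpleGraph (Fin n) × Set (Fin n)) : Set (Fin n) :=
  {v | |1 - 2 * (q : ℝ)| / 2 * (((n : ℝ) - 1) * p) ≤
    |excess ω.1 ω.2 v - ((n : ℝ) - 1) * (p * (1 - 2 * q))|}

lemma measureReal_ncard_atypical_ge {n : ℕ} (hn : 2 ≤ n) (p q : I) (hp : 0 < (p : ℝ))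
    (hq : (q : ℝ) ≠ 1 / 2) {δ : ℝ} (hδ : 0 < δ) :
    (law n p q).real {ω | δ * n ≤ ((atypical p q ω).ncard : ℝ)}
      ≤ 4 / (δ * (1 - 2 * q) ^ 2 * (((n : ℝ) - 1) * p)) := by
  classical
  have hn' : (2 : ℝ) ≤ n := by exact_mod_cast hn
  have hμ : 0 < |1 - 2 * (q : ℝ)| := abs_pos.2 fun h ↦ hq (by linarith)
  have hm : 0 < ((n : ℝ) - 1) * p := mul_pos (by linarith) hp
  set t : ℝ := |1 - 2 * (q : ℝ)| / 2 * (((n : ℝ) - 1) * p) with ht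
  have ht0 : 0 < t := by positivity
  have hmean : ∫ ω, ((atypical p q ω).ncard : ℝ) ∂(law n p q)
      ≤ n * (((n : ℝ) - 1) * p / t ^ 2) := by
    simp only [ncard_eq_sum_indicator]
    rw [integral_finsetSum _ (fun _ _ ↦ .of_finite)]
    calc _ ≤ ∑ v : Fin n, ((n : ℝ) - 1) * p / t ^ 2 := by
          refine Finset.sum_le_sum fun v _ ↦ ?_
          refine le_trans (le_of_eq ?_) (measureReal_excess_deviation n p q v ht0)
          rw [← integral_indicator_one (.of_discrete)]
          refine integral_congr_ae (.of_forall fun ω ↦ ?_)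
          simp only [Set.indicator_apply, atypical, ht, Set.mem_ofPred_eq, Pi.one_apply]
          congr!
      _ = _ := by simp
  have hM := (mul_meas_ge_le_integral_of_nonneg (μ := law n p q)
    (.of_forall fun ω ↦ Nat.cast_nonneg (atypical p q ω).ncard) (.of_finite) (δ * n)).trans hmean
  have hδn : 0 < δ * n := by positivity
  rw [← le_div_iff₀' hδn] at hM
  refine hM.trans (le_of_eq ?_)
  have hsq : t ^ 2 = (1 - 2 * (q : ℝ)) ^ 2 / 4 * (((n : ℝ) - 1) * p) ^ 2 := by
    rw [ht, mul_pow, div_pow, sq_abs]; norm_num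
  rw [hsq]
  have hμ2 : (1 - 2 * (q : ℝ)) ≠ 0 := abs_pos.1 hμ
  generalize ((n : ℝ) - 1) * p = M at hm
  field_simp

/-- Chebyshev at distance `qn/2`. It turns an `o(n)` error into one relative to `A(0)`. -/
lemma measureReal_initialSize_le (n : ℕ) (hn : 1 ≤ n) (p q : I) (hq : 0 < (q : ℝ)) :
    (law n p q).real {ω | (initialSize ω : ℝ) ≤ q * n / 2} ≤ 4 / (q * n) := by
  classical
  have hn' : (1 : ℝ) ≤ n := by exact_mod_cast hn
  have hint (g : Set (Fin n) → ℝ) :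
      ∫ ω, g ω.2 ∂(law n p q) = ∫ A, g A ∂(setBernoulli Set.univ q) := by
    simpa using integral_law_mul p q (fun _ ↦ 1) g
  have h1 (w : Fin n) :
      ∫ ω, (if w ∈ ω.2 then (1 : ℝ) else 0) ∂(law n p q) = q := by
    rw [hint (fun A ↦ if w ∈ A then (1 : ℝ) else 0)]
    have := integral_setBernoulli_prod_finset Set.univ q {w} (by simp)
      (fun _ P ↦ if P then (1 : ℝ) else 0)
    simpa using this
  have hqn : 0 < q * (n : ℝ) / 2 := by positivity
  have key := measureReal_abs_sum_sub_ge (law n p q) (Finset.univ : Finset (Fin n))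
    (fun w ω ↦ if w ∈ ω.2 then (1 : ℝ) else 0) q q (fun w _ ↦ h1 w) ?_ ?_ hqn
  · refine (measureReal_mono ?_ (measure_ne_top _ _)).trans (key.trans (le_of_eq ?_))
    · intro ω hω
      simp only [Set.mem_ofPred_eq, Finset.card_univ, Fintype.card_fin] at hω ⊢
      rw [← ncard_eq_sum_indicator]
      rw [initialSize] at hω
      rw [abs_sub_comm]
      refine le_trans ?_ (le_abs_self _)
      linarith
    · simp only [Finset.card_univ, Fintype.card_fin]
      field_simp
      norm_num
  · intro w _
    refine le_of_eq (Eq.trans (integral_congr_ae (.of_forall fun ω ↦ ?_)) (h1 w))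
    dsimp only
    split_ifs <;> norm_num
  · intro w _ w' _ hne
    have := integral_setBernoulli_prod_finset Set.univ q {w, w'} (by simp)
      (fun _ P ↦ if P then (1 : ℝ) else 0)
    simp only [Finset.prod_pair hne, if_true, if_false] at this
    rw [hint (fun A ↦ (if w ∈ A then (1 : ℝ) else 0) * (if w' ∈ A then (1 : ℝ) else 0)), this]
    ring

/-! ### Edges inside small vertex sets -/

open Classical in
-- Handshake count: an unordered pair comes from at most two ordered ones.
lemma sum_ncard_neighborSet_inter_le {V : Type*} [Fintype V] [DecidableEq V] (G : SimpleGraph V) (S : Finset V) :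
    ∑ v ∈ S, ((G.neighborSet v ∩ S).ncard : ℝ)
      ≤ 2 * ∑ e ∈ S.offDiag.image (Function.uncurry Sym2.mk),
        (if e ∈ G.edgeSet then (1 : ℝ) else 0) := by
  have h1 : ∑ v ∈ S, ((G.neighborSet v ∩ S).ncard : ℝ)
      = ∑ x ∈ S.offDiag, (if Function.uncurry Sym2.mk x ∈ G.edgeSet then (1 : ℝ) else 0) := by
    have h2 : ∑ x ∈ S.offDiag, (if Function.uncurry Sym2.mk x ∈ G.edgeSet then (1 : ℝ) else 0)
        = ∑ x ∈ S ×ˢ S, (if Function.uncurry Sym2.mk x ∈ G.edgeSet then (1 : ℝ) else 0) := by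
      refine Finset.sum_subset (fun x hx ↦ ?_) fun x hx hx' ↦ ?_
      · rw [Finset.mem_offDiag] at hx
        exact Finset.mem_product.2 ⟨hx.1, hx.2.1⟩
      · rw [Finset.mem_product] at hx
        have : x.1 = x.2 := by
          by_contra h
          exact hx' (Finset.mem_offDiag.2 ⟨hx.1, hx.2, h⟩)
        simp [Function.uncurry, this]
    rw [h2, Finset.sum_product]
    refine Finset.sum_congr rfl fun v _ ↦ ?_
    rw [ncard_eq_sum_indicator, ← Finset.sum_subset (Finset.subset_univ S)]
    · refine Finset.sum_congr rfl fun w hw ↦ ?_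
      simp [hw, Function.uncurry]
    · intro w _ hw
      simp [hw]
  rw [h1, Finset.sum_comp (fun e ↦ if e ∈ G.edgeSet then (1 : ℝ) else 0), Finset.mul_sum]
  refine Finset.sum_le_sum fun e _ ↦ ?_
  rw [nsmul_eq_mul]
  refine mul_le_mul_of_nonneg_right ?_ (by split_ifs <;> norm_num)
  induction e with
  | h a b =>
    have : {x ∈ S.offDiag | Function.uncurry Sym2.mk x = s(a, b)} ⊆ {(a, b), (b, a)} := by
      intro x hx
      simp only [Finset.mem_filter, Function.uncurry, Sym2.eq_iff] at hx
      simp only [Finset.mem_insert, Finset.mem_singleton, Prod.ext_iff]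
      exact hx.2
    exact_mod_cast (Finset.card_le_card this).trans Finset.card_le_two

/-- Chernoff with exponential parameter 1 for the number of edges inside `S`, compared with `s²p`.
-/
lemma measureReal_sum_ncard_neighborSet_inter_ge {n : ℕ} (p q : I) (S : Finset (Fin n)) :
    (law n p q).real {ω | 2 * ((S.card : ℝ) ^ 2 * p) ≤
        ∑ v ∈ S, ((ω.1.neighborSet v ∩ S).ncard : ℝ)}
      ≤ Real.exp (-((S.card : ℝ) ^ 2 * p / 8)) := by
  classical
  set T := S.offDiag.image (Function.uncurry Sym2.mk) with hT
  set s : ℝ := (S.card : ℝ) with hs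
  have hp0 : 0 ≤ (p : ℝ) := p.2.1
  have hTcard : (T.card : ℝ) ≤ s ^ 2 / 2 := by
    rw [hT, Sym2.card_image_offDiag, Nat.cast_choose_two, hs]
    have : (0 : ℝ) ≤ S.card := Nat.cast_nonneg _
    nlinarith
  have hdiag : ∀ e ∈ T, ¬ e.IsDiag := by
    intro e he
    simp only [hT, Finset.mem_image, Finset.mem_offDiag] at he
    obtain ⟨x, hx, rfl⟩ := he
    simpa [Function.uncurry] using hx.2.2
  have hmgf : ∫ ω, ∏ e ∈ T, Real.exp (if e ∈ ω.1.edgeSet then (1 : ℝ) else 0) ∂(law n p q)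
      ≤ Real.exp (7 / 8 * (s ^ 2 * p)) := by
    have h1 := integral_law_mul p q
      (fun G ↦ ∏ e ∈ T, Real.exp (if e ∈ G.edgeSet then (1 : ℝ) else 0)) (fun _ ↦ 1)
    have h2 := integral_binomialRandom_prod_finset p T hdiag
      (fun _ P ↦ Real.exp (if P then (1 : ℝ) else 0))
    simp only [mul_one, integral_const, probReal_univ, smul_eq_mul, if_true, if_false,
      Finset.prod_const, Real.exp_zero] at h1 h2
    have h3 : ∫ ω, ∏ e ∈ T, Real.exp (if e ∈ ω.1.edgeSet then (1 : ℝ) else 0) ∂(law n p q)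
        = ((p : ℝ) * Real.exp 1 + (1 - p)) ^ T.card := by
      refine (h1.trans ?_).trans h2
      congr!
    rw [h3]
    -- So `1 + p(e-1) ≤ exp(7p/4)`; with at most `s²/2` pairs the exponent is `7s²p/8`, which leaves
    -- `s²p/8` to spare.
    have he : Real.exp 1 ≤ 2.75 := Real.exp_one_lt_d9.le.trans (by norm_num)
    calc ((p : ℝ) * Real.exp 1 + (1 - p)) ^ T.card
        ≤ Real.exp (7 / 4 * p) ^ T.card := by
          refine pow_le_pow_left₀ ?_ ?_ _
          · have := p.2.2
            have := Real.exp_pos 1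
            nlinarith [mul_nonneg hp0 this.le]
          · refine le_trans ?_ (Real.add_one_le_exp _)
            nlinarith
      _ = Real.exp (T.card * (7 / 4 * p)) := (Real.exp_nat_mul _ _).symm
      _ ≤ _ := by
          refine Real.exp_le_exp.2 ?_
          nlinarith [mul_le_mul_of_nonneg_right hTcard hp0]
  have hM := (mul_meas_ge_le_integral_of_nonneg (μ := law n p q)
    (f := fun ω ↦ ∏ e ∈ T, Real.exp (if e ∈ ω.1.edgeSet then (1 : ℝ) else 0))
    (.of_forall fun ω ↦ Finset.prod_nonneg fun _ _ ↦ (Real.exp_pos _).le) (.of_finite)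
    (Real.exp (s ^ 2 * p))).trans hmgf
  rw [← le_div_iff₀' (Real.exp_pos _), ← Real.exp_sub] at hM
  refine (measureReal_mono ?_ (measure_ne_top _ _)).trans (hM.trans (le_of_eq ?_))
  · intro ω hω
    simp only [Set.mem_ofPred_eq] at hω ⊢
    rw [← Real.exp_sum, Real.exp_le_exp]
    have := hω.trans (sum_ncard_neighborSet_inter_le ω.1 S)
    convert le_of_mul_le_mul_left this two_pos
  · congr 1; ring

/-- With high probability no set of `s` vertices spans many edges. -/
lemma measureReal_exists_dense_le {n : ℕ} (p q : I) (s : ℕ) :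
    (law n p q).real {ω | ∃ S : Finset (Fin n), S.card = s ∧ 2 * ((s : ℝ) ^ 2 * p) ≤
        ∑ v ∈ S, ((ω.1.neighborSet v ∩ S).ncard : ℝ)}
      ≤ Real.exp (n - (s : ℝ) ^ 2 * p / 8) := by
  classical
  calc _ ≤ (law n p q).real (⋃ S ∈ Finset.powersetCard s (Finset.univ : Finset (Fin n)),
        {ω | 2 * ((S.card : ℝ) ^ 2 * p) ≤
          ∑ v ∈ S, ((ω.1.neighborSet v ∩ S).ncard : ℝ)}) := by
        refine measureReal_mono ?_ (measure_ne_top _ _)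
        rintro ω ⟨S, rfl, hS⟩
        simp only [Set.mem_iUnion]
        exact ⟨S, by simp, hS⟩
    _ ≤ ∑ S ∈ Finset.powersetCard s (Finset.univ : Finset (Fin n)),
        Real.exp (-((s : ℝ) ^ 2 * p / 8)) := by
        refine (measureReal_biUnion_finset_le _ _).trans (Finset.sum_le_sum fun S hS ↦ ?_)
        have := measureReal_sum_ncard_neighborSet_inter_ge p q S
        rwa [(Finset.mem_powersetCard.1 hS).2] at this ⊢
    _ ≤ Real.exp n * Real.exp (-((s : ℝ) ^ 2 * p / 8)) := by
        rw [Finset.sum_const, nsmul_eq_mul]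
        gcongr
        rw [Finset.card_powersetCard, Finset.card_univ, Fintype.card_fin]
        calc ((n.choose s : ℕ) : ℝ) ≤ 2 ^ n := by exact_mod_cast Nat.choose_le_two_pow n s
          _ ≤ Real.exp 1 ^ n := by
              gcongr
              have := Real.add_one_le_exp 1
              linarith
          _ = Real.exp n := by rw [← Real.exp_nat_mul, mul_one]
    _ = _ := by rw [← Real.exp_add, sub_eq_add_neg]

/-! ### Deterministic properties of the process -/

section Deterministic

variable {V : Type*} {rule : TieRule} {G : SimpleGraph V} {A : Set V}

/-- Both rules imply the non-strict inequality, which survives enlarging the active set; the upper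
bound needs nothing else from the rule. -/
lemma Activates.ncard_le [Finite V] {B C : Set V} {v : V} (h : Activates rule G B v)
    (hBC : B ⊆ C) : (G.neighborSet v \ C).ncard ≤ (G.neighborSet v ∩ C).ncard := by
  have h1 : (G.neighborSet v \ C).ncard ≤ (G.neighborSet v \ B).ncard :=
    Set.ncard_le_ncard (Set.sdiff_subset_sdiff_right hBC) (Set.toFinite _)
  have h2 : (G.neighborSet v ∩ B).ncard ≤ (G.neighborSet v ∩ C).ncard :=
    Set.ncard_le_ncard (Set.inter_subset_inter_right _ hBC) (Set.toFinite _)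
  cases rule <;> simp only [Activates] at h <;> omega

lemma activates_of_excess_neg {v : V} (h : excess G A v < 0) : Activates rule G A v := by
  have h' : (G.neighborSet v \ A).ncard < (G.neighborSet v ∩ A).ncard := by
    have : ((G.neighborSet v \ A).ncard : ℝ) < (G.neighborSet v ∩ A).ncard := by
      unfold excess at h; linarith
    exact_mod_cast this
  cases rule <;> simp only [Activates] <;> omega

lemma subset_step (B : Set V) : B ⊆ step rule G B := Set.subset_union_left

lemma monotone_iterate_step : Monotone fun k ↦ (step rule G)^[k] A := by
  refine monotone_nat_of_le_succ fun k ↦ ?_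
  simp only [Function.iterate_succ_apply']
  exact subset_step _

lemma subset_finalSet : A ⊆ finalSet rule G A := Set.subset_iUnion (fun k ↦ (step rule G)^[k] A) 0

lemma mem_finalSet_of_activates {v : V} (h : Activates rule G A v) : v ∈ finalSet rule G A :=
  Set.mem_iUnion.2 ⟨1, Or.inr h⟩

/-- The weak rule's demand for an active neighbour matters here: otherwise isolated vertices would
activate. -/
lemma finalSet_empty : finalSet rule G (∅ : Set V) = ∅ := by
  have hstep : step rule G (∅ : Set V) = ∅ := by
    ext v
    cases rule <;> simp [step, Activates]
  refine Set.iUnion_eq_empty.2 fun k ↦ ?_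
  exact Function.iterate_fixed hstep k

lemma exists_activates_of_mem_iterate {k : ℕ} {v : V} (hv : v ∈ (step rule G)^[k] A)
    (hvA : v ∉ A) : ∃ i < k, Activates rule G ((step rule G)^[i] A) v := by
  induction k with
  | zero => exact absurd hv hvA
  | succ k ih =>
    rw [Function.iterate_succ_apply'] at hv
    rcases hv with hv | hv
    · obtain ⟨i, hi, h⟩ := ih hv
      exact ⟨i, by omega, h⟩
    · exact ⟨k, by omega, hv⟩

lemma exists_finalSet_subset_iterate [Finite V] :
    ∃ k, finalSet rule G A ⊆ (step rule G)^[k] A := by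
  have h (v : V) : ∃ k, v ∈ finalSet rule G A → v ∈ (step rule G)^[k] A := by
    by_cases hv : v ∈ finalSet rule G A
    · obtain ⟨k, hk⟩ := Set.mem_iUnion.1 hv
      exact ⟨k, fun _ ↦ hk⟩
    · exact ⟨0, fun h ↦ absurd h hv⟩
  choose k hk using h
  obtain ⟨K, hK⟩ := (Set.finite_range k).bddAbove
  exact ⟨K, fun v hv ↦ monotone_iterate_step (hK ⟨v, rfl⟩) (hk v hv)⟩

/-- Passing from `A` to `A ∪ S` changes each of the two counts by at most the degree of `v` into
`S`. -/
lemma excess_le_two_mul [Finite V] {S : Set V} {v : V}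
    (h : (G.neighborSet v \ (A ∪ S)).ncard ≤ (G.neighborSet v ∩ (A ∪ S)).ncard) :
    excess G A v ≤ 2 * (G.neighborSet v ∩ S).ncard := by
  have h1 : (G.neighborSet v \ A).ncard
      ≤ (G.neighborSet v \ (A ∪ S)).ncard + (G.neighborSet v ∩ S).ncard := by
    refine (Set.ncard_le_ncard ?_ (Set.toFinite _)).trans (Set.ncard_union_le _ _)
    intro w hw
    by_cases hwS : w ∈ S
    · exact Or.inr ⟨hw.1, hwS⟩
    · exact Or.inl ⟨hw.1, fun h ↦ h.elim hw.2 hwS⟩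
  have h2 : (G.neighborSet v ∩ (A ∪ S)).ncard
      ≤ (G.neighborSet v ∩ A).ncard + (G.neighborSet v ∩ S).ncard := by
    rw [Set.inter_union_distrib_left]
    exact Set.ncard_union_le _ _
  have h3 : (G.neighborSet v \ A).ncard
      ≤ (G.neighborSet v ∩ A).ncard + 2 * (G.neighborSet v ∩ S).ncard := by omega
  have h4 : ((G.neighborSet v \ A).ncard : ℝ)
      ≤ (G.neighborSet v ∩ A).ncard + 2 * (G.neighborSet v ∩ S).ncard := by exact_mod_cast h3
  unfold excess
  linarith

/-- If more than `s` vertices get activated, then the first `s` of them (with respect to a suitable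
order) form a set in which every vertex has many neighbours. -/
lemma exists_finset_excess_le [Fintype V] {s : ℕ} (hs : s < (finalSet rule G A \ A).ncard) :
    ∃ S : Finset V, S.card = s ∧
      ∀ v ∈ S, excess G A v ≤ 2 * (G.neighborSet v ∩ S).ncard := by
  classical
  have hex : ∃ k, s < ((step rule G)^[k] A \ A).ncard := by
    obtain ⟨k, hk⟩ := exists_finalSet_subset_iterate (rule := rule) (G := G) (A := A)
    exact ⟨k, hs.trans_le (Set.ncard_le_ncard (Set.sdiff_subset_sdiff_left hk) (Set.toFinite _))⟩
  obtain ⟨j, hj⟩ : ∃ j, Nat.find hex = j + 1 := by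
    refine Nat.exists_eq_succ_of_ne_zero fun h0 ↦ ?_
    have := Nat.find_spec hex
    rw [h0] at this
    simp at this
  have hbig := Nat.find_spec hex
  have hsmall := Nat.find_min hex (m := j) (by omega)
  rw [hj] at hbig
  rw [Set.ncard_eq_toFinset_card'] at hbig hsmall
  -- Round `j + 1` is the first with more than `s` new vertices. `S` contains all those of round `j`
  -- and is filled up from round `j + 1`, so whatever activated a vertex of `S` lies in `A ∪ S`.
  obtain ⟨S, hS1, hS2, hS3⟩ := Finset.exists_subsuperset_card_eq
    (Set.toFinset_subset_toFinset.2 (Set.sdiff_subset_sdiff_left (t := A)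
      (monotone_iterate_step (rule := rule) (G := G) (A := A) (Nat.le_succ j))))
    (not_lt.1 hsmall) hbig.le
  have hSmem {v : V} (hv : v ∈ S) : v ∈ (step rule G)^[j + 1] A ∧ v ∉ A := by
    have h := hS2 hv
    rwa [Set.mem_toFinset] at h
  refine ⟨S, hS3, fun v hv ↦ ?_⟩
  obtain ⟨i, hi, hact⟩ := exists_activates_of_mem_iterate (hSmem hv).1 (hSmem hv).2
  refine excess_le_two_mul (hact.ncard_le ?_)
  intro w hw
  by_cases hwA : w ∈ A
  · exact Or.inl hwA
  · refine Or.inr (hS1 (Set.mem_toFinset.2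
      ⟨monotone_iterate_step (Nat.lt_succ_iff.1 hi) hw, hwA⟩))

end Deterministic

lemma initialSize_le_finalSize (rule : TieRule) {n : ℕ} (ω : SimpleGraph (Fin n) × Set (Fin n)) :
    initialSize ω ≤ finalSize rule ω :=
  Set.ncard_le_ncard subset_finalSet (Set.toFinite _)

lemma finalSize_eq_zero (rule : TieRule) {n : ℕ} (ω : SimpleGraph (Fin n) × Set (Fin n))
    (h : initialSize ω = 0) : finalSize rule ω = 0 := by
  have h' : ω.2 = ∅ := (Set.ncard_eq_zero (Set.toFinite _)).1 h
  rw [finalSize, h', finalSet_empty, Set.ncard_empty]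

lemma sub_finalSize_le_ncard_atypical (rule : TieRule) {n : ℕ} (hn : 2 ≤ n) (p q : I)
    (hp : 0 < (p : ℝ)) (hq : 1 / 2 < (q : ℝ)) (ω : SimpleGraph (Fin n) × Set (Fin n)) :
    (n : ℝ) - finalSize rule ω ≤ (atypical p q ω).ncard := by
  have hn' : (2 : ℝ) ≤ n := by exact_mod_cast hn
  have hm : 0 < ((n : ℝ) - 1) * p := mul_pos (by linarith) hp
  have hsub : (Set.univ : Set (Fin n)) ⊆ finalSet rule ω.1 ω.2 ∪ atypical p q ω := by
    intro v _
    refine or_iff_not_imp_right.2 fun hv ↦ mem_finalSet_of_activates (activates_of_excess_neg ?_)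
    simp only [atypical, Set.mem_ofPred_eq, not_le] at hv
    rw [abs_of_neg (by linarith : 1 - 2 * (q : ℝ) < 0)] at hv
    have := (abs_lt.1 hv).2
    nlinarith
  have h := (Set.ncard_le_ncard hsub (Set.toFinite _)).trans (Set.ncard_union_le _ _)
  rw [Set.ncard_univ, Nat.card_eq_fintype_card, Fintype.card_fin] at h
  have h' : (n : ℝ) ≤ finalSize rule ω + (atypical p q ω).ncard := by exact_mod_cast h
  linarith

lemma exists_dense_or_atypical (rule : TieRule) {n : ℕ} (p q : I)
    (ω : SimpleGraph (Fin n) × Set (Fin n)) {s : ℕ}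
    (hqs : 16 * (s : ℝ) ≤ ((n : ℝ) - 1) * (1 - 2 * q)) (hq : (q : ℝ) < 1 / 2)
    (hs : initialSize ω + s < finalSize rule ω) :
    (s : ℝ) / 2 ≤ (atypical p q ω).ncard ∨
      ∃ S : Finset (Fin n), S.card = s ∧ 2 * ((s : ℝ) ^ 2 * p) ≤
        ∑ v ∈ S, ((ω.1.neighborSet v ∩ S).ncard : ℝ) := by
  classical
  refine or_iff_not_imp_left.2 fun hB ↦ ?_
  rw [not_le] at hB
  have hs' : s < (finalSet rule ω.1 ω.2 \ ω.2).ncard := by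
    rw [Set.ncard_sdiff subset_finalSet (Set.toFinite _)]
    unfold initialSize finalSize at hs
    omega
  obtain ⟨S, hcard, hS⟩ := exists_finset_excess_le hs'
  refine ⟨S, hcard, ?_⟩
  have hμ : 0 < 1 - 2 * (q : ℝ) := by linarith
  have hp0 : 0 ≤ (p : ℝ) := p.2.1
  have hs0 : (0 : ℝ) ≤ s := Nat.cast_nonneg s
  set c : ℝ := (1 - 2 * (q : ℝ)) / 2 * (((n : ℝ) - 1) * p) with hc
  have hcs : 8 * (s : ℝ) * p ≤ c := by
    have := mul_le_mul_of_nonneg_right hqs hp0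
    rw [hc]; linarith
  have hgood : (s : ℝ) / 2 ≤ (S \ (atypical p q ω).toFinset).card := by
    have h := Finset.le_card_sdiff (atypical p q ω).toFinset S
    rw [← Set.ncard_eq_toFinset_card', hcard, tsub_le_iff_right] at h
    have h' : (s : ℝ) ≤ (S \ (atypical p q ω).toFinset).card + (atypical p q ω).ncard := by
      exact_mod_cast h
    linarith
  have hsum : (S \ (atypical p q ω).toFinset).card * (c / 2)
      ≤ ∑ v ∈ S, ((ω.1.neighborSet v ∩ S).ncard : ℝ) := by
    rw [← nsmul_eq_mul]
    refine (Finset.card_nsmul_le_sum _ (fun v ↦ ((ω.1.neighborSet v ∩ S).ncard : ℝ)) _ ?_).trans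
      (Finset.sum_le_sum_of_subset_of_nonneg Finset.sdiff_subset fun _ _ _ ↦ Nat.cast_nonneg _)
    intro v hv
    rw [Finset.mem_sdiff, Set.mem_toFinset] at hv
    have h1 := hS v hv.1
    have h2 := hv.2
    simp only [atypical, Set.mem_ofPred_eq, not_le, abs_of_pos hμ] at h2
    have h3 := (abs_lt.1 h2).1
    have h4 : ((n : ℝ) - 1) * (p * (1 - 2 * q)) = 2 * c := by rw [hc]; ring
    rw [h4] at h3
    linarith
  have hc0 : 0 ≤ c := le_trans (by positivity) hcs
  -- At least `s/2` typical vertices, each of degree at least `c/2 ≥ 4sp` into `S`, give `2s²p`.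
  nlinarith [mul_le_mul_of_nonneg_right hgood (by linarith : 0 ≤ c / 2),
    mul_le_mul_of_nonneg_left hcs hs0]

/-! ### Limits -/

lemma tendsto_measure_of_real_le {Ω : ℕ → Type*} [∀ n, MeasurableSpace (Ω n)]
    (μ : ∀ n, Measure (Ω n)) [∀ n, IsFiniteMeasure (μ n)] (S : ∀ n, Set (Ω n)) {b : ℕ → ℝ}
    (hb : Tendsto b atTop (𝓝 0)) (h : ∀ᶠ n in atTop, (μ n).real (S n) ≤ b n) :
    Tendsto (fun n ↦ μ n (S n)) atTop (𝓝 0) := by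
  have hb' : Tendsto (fun n ↦ ENNReal.ofReal (b n)) atTop (𝓝 0) := by
    simpa using ENNReal.tendsto_ofReal hb
  refine tendsto_of_tendsto_of_tendsto_of_le_of_le' tendsto_const_nhds hb'
    (.of_forall fun _ ↦ zero_le) ?_
  filter_upwards [h] with n hn
  rw [← ENNReal.ofReal_toReal (measure_ne_top (μ n) (S n))]
  exact ENNReal.ofReal_le_ofReal hn

lemma tendsto_sub_one_mul_atTop {p : ℕ → I}
    (hp : (fun n : ℕ => 1 / (n : ℝ)) =o[atTop] (fun n : ℕ => (p n : ℝ))) :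
    Tendsto (fun n : ℕ ↦ ((n : ℝ) - 1) * p n) atTop atTop := by
  refine tendsto_atTop.2 fun C ↦ ?_
  have hC : 0 < 2 * (|C| + 1) := by positivity
  filter_upwards [hp.bound (inv_pos.2 hC), eventually_ge_atTop 2] with n h hn
  have hn' : (2 : ℝ) ≤ n := by exact_mod_cast hn
  have hn0 : (0 : ℝ) < n := by linarith
  rw [Real.norm_of_nonneg (by positivity), Real.norm_of_nonneg (p n).2.1, inv_mul_eq_div,
    div_le_div_iff₀ hn0 hC] at h
  have := (p n).2.1
  nlinarith [le_abs_self C]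

lemma tendsto_div_mul_sub_one_mul {p : ℕ → I}
    (hp : (fun n : ℕ => 1 / (n : ℝ)) =o[atTop] (fun n : ℕ => (p n : ℝ))) {a c : ℝ} (hc : 0 < c) :
    Tendsto (fun n : ℕ ↦ a / (c * (((n : ℝ) - 1) * p n))) atTop (𝓝 0) :=
  ((tendsto_sub_one_mul_atTop hp).const_mul_atTop hc).const_div_atTop a

lemma eventually_pos {p : ℕ → I}
    (hp : (fun n : ℕ => 1 / (n : ℝ)) =o[atTop] (fun n : ℕ => (p n : ℝ))) :
    ∀ᶠ n in atTop, 0 < (p n : ℝ) := by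
  filter_upwards [(tendsto_sub_one_mul_atTop hp).eventually_gt_atTop 0,
    eventually_ge_atTop 1] with n h hn
  have hn' : (1 : ℝ) ≤ n := by exact_mod_cast hn
  exact pos_of_mul_pos_right h (by linarith)

/-- Below the threshold only few vertices get activated. -/
lemma tendsto_measure_finalSize_sub_initialSize (rule : TieRule) {p : ℕ → I}
    (hp : (fun n : ℕ => 1 / (n : ℝ)) =o[atTop] (fun n : ℕ => (p n : ℝ)))
    (q : I) (hq : (q : ℝ) < 1 / 2) {δ : ℝ} (hδ : 0 < δ) :
    Tendsto (fun n ↦ (law n (p n) q)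
      {ω | δ * n < (finalSize rule ω : ℝ) - initialSize ω}) atTop (𝓝 0) := by
  have hμ : 0 < 1 - 2 * (q : ℝ) := by linarith
  -- The cap makes `16s ≤ (n-1)(1-2q)`, as `exists_dense_or_atypical` requires.
  set d : ℝ := min δ ((1 - 2 * q) / 64) with hd
  have hd0 : 0 < d := lt_min hδ (by positivity)
  have hdδ : d ≤ δ := min_le_left _ _
  have hdq : d ≤ (1 - 2 * q) / 64 := min_le_right _ _
  have hlim : Tendsto (fun n : ℕ ↦ 4 / (d / 4 * (1 - 2 * (q : ℝ)) ^ 2 * (((n : ℝ) - 1) * p n))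
      + Real.exp (-(n : ℝ))) atTop (𝓝 0) := by
    simpa using (tendsto_div_mul_sub_one_mul hp (by positivity)).add
      (Real.tendsto_exp_neg_atTop_nhds_zero.comp tendsto_natCast_atTop_atTop)
  refine tendsto_measure_of_real_le _ _ hlim ?_
  -- `64 / d²` forces `s²p/8 ≥ 2n`, which beats the `e^n` of the union bound; `2 / d` keeps the
  -- floor `s` above `dn/2`.
  filter_upwards [eventually_pos hp, eventually_ge_atTop 2,
    (tendsto_sub_one_mul_atTop hp).eventually_ge_atTop (64 / d ^ 2),
    (tendsto_natCast_atTop_atTop (R := ℝ)).eventually_ge_atTop (2 / d)] with n hpn hn hnp hnd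
  have hn' : (2 : ℝ) ≤ n := by exact_mod_cast hn
  set s : ℕ := ⌊d * n⌋₊ with hs
  have hs_le : (s : ℝ) ≤ d * n := Nat.floor_le (by positivity)
  have hs_ge : d * n / 2 ≤ s := by
    have := Nat.lt_floor_add_one (d * n)
    rw [div_le_iff₀ hd0] at hnd
    rw [← hs] at this
    linarith
  calc (law n (p n) q).real {ω | δ * n < (finalSize rule ω : ℝ) - initialSize ω}
      ≤ (law n (p n) q).real ({ω | d / 4 * n ≤ ((atypical (p n) q ω).ncard : ℝ)} ∪
          {ω | ∃ S : Finset (Fin n), S.card = s ∧ 2 * ((s : ℝ) ^ 2 * p n) ≤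
            ∑ v ∈ S, ((ω.1.neighborSet v ∩ S).ncard : ℝ)}) := by
        refine measureReal_mono ?_ (measure_ne_top _ _)
        intro ω hω
        have hlt : initialSize ω + s < finalSize rule ω := by
          have h1 : δ * n < (finalSize rule ω : ℝ) - initialSize ω := hω
          have h2 : (initialSize ω : ℝ) + s < finalSize rule ω := by nlinarith
          exact_mod_cast h2
        refine (exists_dense_or_atypical rule (p n) q ω ?_ hq hlt).imp_left fun h ↦ ?_
        · nlinarith
        · exact le_trans (by linarith) h
    _ ≤ _ := measureReal_union_le _ _
    _ ≤ _ := by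
        refine add_le_add (measureReal_ncard_atypical_ge hn (p n) q hpn hq.ne (by positivity))
          ((measureReal_exists_dense_le (p n) q s).trans (Real.exp_le_exp.2 ?_))
        have h1 : (d * n / 2) ^ 2 ≤ (s : ℝ) ^ 2 := pow_le_pow_left₀ (by positivity) hs_ge 2
        have h2 : 64 ≤ d ^ 2 * (n * p n) := by
          rw [div_le_iff₀' (by positivity)] at hnp
          refine hnp.trans ?_
          gcongr
          linarith
        have h3 : (d * n / 2) ^ 2 * p n ≤ (s : ℝ) ^ 2 * p n := by gcongr
        have h4 : (d * n / 2) ^ 2 * p n = n * (d ^ 2 * (n * p n)) / 4 := by ring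
        nlinarith

end MajorityBootstrap

open MajorityBootstrap in
theorem mainTheorem4 (rule : MajorityBootstrap.TieRule)
    (p : ℕ → I) (hp : (fun n : ℕ => 1 / (n : ℝ)) =o[atTop] (fun n : ℕ => (p n : ℝ)))
    (q : I) (hq0 : 0 < (q : ℝ)) (hq1 : (q : ℝ) < 1) :
    ((q : ℝ) < 1 / 2 →
      ∃ R : ∀ n : ℕ, SimpleGraph (Fin n) × Set (Fin n) → ℝ,
        (∀ n ω, (MajorityBootstrap.finalSize rule ω : ℝ)
          = MajorityBootstrap.initialSize ω * (1 + R n ω)) ∧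
        MajorityBootstrap.IsLittleOInProb
          (fun n => MajorityBootstrap.law n (p n) q) R (fun _ => 1)) ∧
    (1 / 2 < (q : ℝ) →
      ∃ R : ∀ n : ℕ, SimpleGraph (Fin n) × Set (Fin n) → ℝ,
        (∀ n ω, (MajorityBootstrap.finalSize rule ω : ℝ) = n - R n ω) ∧
        MajorityBootstrap.IsLittleOInProb
          (fun n => MajorityBootstrap.law n (p n) q) R (fun n => (n : ℝ))) := by
  refine ⟨fun hq ↦ ?_, fun hq ↦ ?_⟩
  -- If `A(0) = 0`, the quotient is 0 by convention, and `A* = 0` as well.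
  · refine ⟨fun n ω ↦ ((finalSize rule ω : ℝ) - initialSize ω) / initialSize ω,
      fun n ω ↦ ?_, fun ε hε ↦ ?_⟩
    · by_cases h : initialSize ω = 0
      · simp [h, finalSize_eq_zero rule ω h]
      · have : (initialSize ω : ℝ) ≠ 0 := by exact_mod_cast h
        field_simp
        ring
    -- Where `A(0) > qn/2`, a relative error above `ε` is an absolute one above `(εq/2)n`.
    · have h1 := tendsto_measure_finalSize_sub_initialSize rule hp q hq
        (δ := ε * q / 2) (by positivity)
      have h2 : Tendsto (fun n ↦ (law n (p n) q) {ω | (initialSize ω : ℝ) ≤ q * n / 2})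
          atTop (𝓝 0) := by
        refine tendsto_measure_of_real_le _ _ (b := fun n : ℕ ↦ 4 / (q * (n : ℝ)))
          ((tendsto_natCast_atTop_atTop.const_mul_atTop hq0).const_div_atTop 4) ?_
        filter_upwards [eventually_ge_atTop 1] with n hn
        exact measureReal_initialSize_le n hn (p n) q hq0
      have h3 := h2.add h1
      rw [add_zero] at h3
      refine tendsto_of_tendsto_of_tendsto_of_le_of_le tendsto_const_nhds h3
        (fun _ ↦ zero_le) fun n ↦ (measure_mono ?_).trans (measure_union_le _ _)
      intro ω hω
      refine or_iff_not_imp_left.2 fun h0 ↦ ?_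
      simp only [Set.mem_ofPred_eq, not_le, mul_one] at hω h0 ⊢
      have hpos : 0 < (initialSize ω : ℝ) := lt_of_le_of_lt (by positivity) h0
      have hle : (initialSize ω : ℝ) ≤ finalSize rule ω := by
        exact_mod_cast initialSize_le_finalSize rule ω
      rw [abs_of_nonneg (div_nonneg (by linarith) hpos.le), lt_div_iff₀ hpos] at hω
      nlinarith
  · refine ⟨fun n ω ↦ n - finalSize rule ω, fun n ω ↦ by ring, fun ε hε ↦ ?_⟩
    have hμ : (1 - 2 * (q : ℝ)) ≠ 0 := by linarith
    refine tendsto_measure_of_real_le _ _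
      (tendsto_div_mul_sub_one_mul hp (a := 4) (c := ε * (1 - 2 * q) ^ 2) (by positivity)) ?_
    filter_upwards [eventually_pos hp, eventually_ge_atTop 2] with n hpn hn
    refine (measureReal_mono ?_ (measure_ne_top _ _)).trans
      (measureReal_ncard_atypical_ge hn (p n) q hpn hq.ne' hε)
    intro ω hω
    simp only [Set.mem_ofPred_eq] at hω ⊢
    have hle : (finalSize rule ω : ℝ) ≤ n := by
      have := Set.ncard_le_card (finalSet rule ω.1 ω.2)
      rw [Nat.card_eq_fintype_card, Fintype.card_fin] at this
      exact_mod_cast this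
    rw [abs_of_nonneg (by linarith)] at hω
    exact hω.le.trans (sub_finalSize_le_ncard_atypical rule hn (p n) q hpn hq ω)
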